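/- Let $d\in\mathbb N$. For multi-indices $\alpha\in\mathbb N^n$ write $|\alpha|=\alpha_1+\dots+\alpha_n$, $\alpha!=\alpha_1!\cdots\alpha_n!$. For real $s\ge 0$, the Gelfand–Shilov space $S^s_s(\mathbb R^n)$ is the set of Schwartz functions $f:\mathbb R^n\to\mathbb C$ for which there exist constants $A,B,c>0$ such that $$|x^\alpha\partial^\beta f(x)|\le c\,A^{|\alpha|}B^{|\beta|}(\alpha!)^s(\beta!)^s\qquad\text{for all }\alpha,\beta\in\mathbb N^n,\ x\in\mathbb R^n,$$ and $\Sigma^1_1(\mathbb R^n)$ is the set of Schwartz functions $f:\mathbb R^n\to\mathbb C$ such that for all $A,B>0$ there exists a constant $c=c(A,B)>0$ with $$|x^\alpha\partial^\beta f(x)|\le c\,A^{|\alpha|}B^{|\beta|}\alpha!\,\beta!\qquad\text{for all }\alpha,\beta\in\mathbb N^n,\ x\in\mathbb R^n.$$ The cross-Wigner distribution of $f,g$ on $\mathbb R^d$ is the function on $\mathbb R^{2d}$ $$W(f,g)(x,\xi)=\int_{\mathbb R^d} f\Big(x+\frac t2\Big)\overline{g\Big(x-\frac t2\Big)}\,e^{-2\pi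 i t\cdot\xi}\,dt,\qquad x,\xi\in\mathbb R^d.$$ **Proposition.** (a) If $s\ge 1/2$ and $f,g\in S^s_s(\mathbb R^d)$, then $W(f,g)\in S^s_s(\mathbb R^{2d})$. (b) If $f,g\in\Sigma^1_1(\mathbb R^d)$, then $W(f,g)\in\Sigma^1_1(\mathbb R^{2d})$. -/

import Mathlib

open scoped SchwartzMap LineDeriv

noncomputable section

namespace GelfandShilov

/-- The length `|α| = α₁ + ⋯ + αₙ` of a multi-index. -/
def multiLength {n : ℕ} (α : Fin n → ℕ) : ℕ := ∑ i, α i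

/-- The factorial `α! = α₁! ⋯ αₙ!` of a multi-index. -/
def multiFactorial {n : ℕ} (α : Fin n → ℕ) : ℕ := ∏ i, (α i).factorial

/-- The monomial `x^α = x₁^α₁ ⋯ xₙ^αₙ`. -/
def monomial {n : ℕ} (α : Fin n → ℕ) (x : EuclideanSpace ℝ (Fin n)) : ℝ := ∏ i, x i ^ α i

/-- The partial derivative `∂^β φ = ∂₁^β₁ (∂₂^β₂ (⋯ (∂ₙ^βₙ φ)))` of a Schwartz function, where `∂ᵢ`
is the derivative in the direction of the `i`-th standard basis vector. -/
def multiDeriv {n : ℕ} (β : Fin n → ℕ) (φ : 𝓢(EuclideanSpace ℝ (Fin n), ℂ)) :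
    𝓢(EuclideanSpace ℝ (Fin n), ℂ) :=
  (List.finRange n).foldr
    (fun i ψ => (fun χ : 𝓢(EuclideanSpace ℝ (Fin n), ℂ) =>
      ∂_{EuclideanSpace.single i (1 : ℝ)} χ)^[β i] ψ) φ

/-- The estimate `|x^α ∂^β φ(x)| ≲ A^|α| B^|β| (α!)^r (β!)^s`, for all multi-indices `α`, `β` and all
points `x`, with an implicit constant `c` that is independent of `α`, `β` and `x`. -/
def Estimate {n : ℕ} (s r A B : ℝ) (φ : 𝓢(EuclideanSpace ℝ (Fin n), ℂ)) : Prop :=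
  ∃ c : ℝ, 0 < c ∧ ∀ (α β : Fin n → ℕ) (x : EuclideanSpace ℝ (Fin n)),
    ‖(monomial α x : ℂ) * multiDeriv β φ x‖ ≤
      c * (A ^ multiLength α * B ^ multiLength β *
        (multiFactorial α : ℝ) ^ r * (multiFactorial β : ℝ) ^ s)

/-- The Gelfand-Shilov space `S^s_r(ℝⁿ)`, as a set of functions: the Schwartz functions that satisfy
the estimate for some `A, B > 0`. -/
def spaceS (n : ℕ) (s r : ℝ) : Set (EuclideanSpace ℝ (Fin n) → ℂ) :=
  {f | ∃ φ : 𝓢(EuclideanSpace ℝ (Fin n), ℂ), ⇑φ = f ∧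
    ∃ A B : ℝ, 0 < A ∧ 0 < B ∧ Estimate s r A B φ}

/-- The Gelfand-Shilov space `Σ^s_r(ℝⁿ)`, as a set of functions: the Schwartz functions that satisfy
the estimate for every `A, B > 0` (the implicit constant may depend on `A` and `B`). -/
def spaceSigma (n : ℕ) (s r : ℝ) : Set (EuclideanSpace ℝ (Fin n) → ℂ) :=
  {f | ∃ φ : 𝓢(EuclideanSpace ℝ (Fin n), ℂ), ⇑φ = f ∧
    ∀ A B : ℝ, 0 < A → 0 < B → Estimate s r A B φ}

/-- The component `x` of a point `z = (x, ξ)` of `ℝ^(2d)`. -/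
def position {d : ℕ} (z : EuclideanSpace ℝ (Fin (d + d))) : EuclideanSpace ℝ (Fin d) :=
  WithLp.toLp 2 fun i => z (Fin.castAdd d i)

/-- The component `ξ` of a point `z = (x, ξ)` of `ℝ^(2d)`. -/
def frequency {d : ℕ} (z : EuclideanSpace ℝ (Fin (d + d))) : EuclideanSpace ℝ (Fin d) :=
  WithLp.toLp 2 fun i => z (Fin.natAdd d i)

/-- The cross-Wigner distribution
`W(f, g)(x, ξ) = ∫ f(x + t/2) conj(g(x - t/2)) e^(-2πi t·ξ) dt`, as a function on `ℝ^(2d)`. -/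
def crossWigner {d : ℕ} (f g : EuclideanSpace ℝ (Fin d) → ℂ)
    (z : EuclideanSpace ℝ (Fin (d + d))) : ℂ :=
  ∫ t : EuclideanSpace ℝ (Fin d),
    f (position z + (1 / 2 : ℝ) • t) * (starRingEnd ℂ) (g (position z - (1 / 2 : ℝ) • t)) *
      Complex.exp (-2 * Real.pi * Complex.I * (inner ℝ t (frequency z) : ℝ))

end GelfandShilov

end

open scoped SchwartzMap LineDeriv

noncomputable section

namespace GelfandShilov

/-! ### Coordinate multiplications and derivatives as operators on Schwartz functions. -/

section

variable {n : ℕ}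

/-! The Wigner transform intertwines the Weyl algebra on ℝ^(2d) with the one on ℝ^d. If `a` is a
coordinate multiplication or a partial derivative on ℝ^(2d), then a W(f,g) = c₁ W(bf,g) + c₂
W(f,bg), with a single letter b on ℝ^d and |c₁|, |c₂| ≤ 2π (`exists_letter_schwartzWigner`). A
product of N letters applied to W(f,g) therefore expands into 2^N terms W(Uf,Vg) with |U| + |V| = N
and total weight at most (4π)^N. The sup norm of each term is controlled by weighted sup norms of Uf
and Vg (`norm_crossWigner_le`).

The words U and V come in arbitrary order, whereas the hypotheses bound only x^α ∂^β f. The main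
work is to pass from these normally ordered products to all words, with a bound A^N (N!)^s
(`norm_word_le`). Each commutation [∂_j, x_j] = 1 shortens a word by two letters, and the loss is
compensated by the growth of (N!)^s. For s ≥ 1/2 this costs a fixed factor per letter
(`exists_wordBound`). That factor deteriorates as A → 0, so (b) needs a finer count for s = 1, which
yields the constant 2A for every A (`wordBound_one`). Since all later losses are also proportional
to A, arbitrarily small constants survive. The way back from words to multi-indices only compares
factorials (`WordBound.estimate`). -/

/-- Multiplication by the `i`-th coordinate. -/
def coordMul (i : Fin n) : Module.End ℂ 𝓢(EuclideanSpace ℝ (Fin n), ℂ) :=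
  (SchwartzMap.smulLeftCLM ℂ fun x : EuclideanSpace ℝ (Fin n) => ((x i : ℝ) : ℂ)).toLinearMap

/-- The derivative in the `i`-th coordinate direction. -/
def coordDeriv (i : Fin n) : Module.End ℂ 𝓢(EuclideanSpace ℝ (Fin n), ℂ) :=
  (LineDeriv.lineDerivOpCLM ℂ 𝓢(EuclideanSpace ℝ (Fin n), ℂ)
    (EuclideanSpace.single i (1 : ℝ))).toLinearMap

theorem hasTemperateGrowth_coord (i : Fin n) :
    (fun x : EuclideanSpace ℝ (Fin n) => ((x i : ℝ) : ℂ)).HasTemperateGrowth :=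
  (Complex.ofRealCLM ∘L EuclideanSpace.proj (𝕜 := ℝ) i).hasTemperateGrowth

@[simp]
theorem coordMul_apply (i : Fin n) (f : 𝓢(EuclideanSpace ℝ (Fin n), ℂ))
    (x : EuclideanSpace ℝ (Fin n)) : coordMul i f x = (x i : ℂ) * f x := by
  simp [coordMul, SchwartzMap.smulLeftCLM_apply_apply (hasTemperateGrowth_coord i)]

theorem coordDeriv_eq (i : Fin n) (f : 𝓢(EuclideanSpace ℝ (Fin n), ℂ)) :
    coordDeriv i f = ∂_{EuclideanSpace.single i (1 : ℝ)} f := rfl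

theorem coordDeriv_apply (i : Fin n) (f : 𝓢(EuclideanSpace ℝ (Fin n), ℂ))
    (x : EuclideanSpace ℝ (Fin n)) :
    coordDeriv i f x = fderiv ℝ f x (EuclideanSpace.single i (1 : ℝ)) := by
  rw [coordDeriv_eq, SchwartzMap.lineDerivOp_apply_eq_fderiv]

/-- Symmetry of the second derivative. -/
theorem commute_coordDeriv (i j : Fin n) : Commute (coordDeriv i) (coordDeriv j) := by
  refine LinearMap.ext fun f => ?_
  ext x
  have h1 : ∀ v w : EuclideanSpace ℝ (Fin n), (∂_{v} (∂_{w} f) : 𝓢(_, ℂ)) x =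
      iteratedFDeriv ℝ 2 f x ![v, w] := by
    intro v w
    rw [← SchwartzMap.iteratedLineDerivOp_eq_iteratedFDeriv]
    simp [LineDeriv.iteratedLineDerivOp_succ_left]
  rw [Module.End.mul_apply, Module.End.mul_apply, coordDeriv_eq, coordDeriv_eq, coordDeriv_eq,
    coordDeriv_eq, h1, h1]
  have h2 : IsSymmSndFDerivAt ℝ f x :=
    (f.smooth 2).contDiffAt.isSymmSndFDerivAt (by simp)
  rw [iteratedFDeriv_two_apply, iteratedFDeriv_two_apply]
  exact h2 _ _

theorem coordDeriv_mul_coordMul (i j : Fin n) :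
    coordDeriv i * coordMul j =
      coordMul j * coordDeriv i + if i = j then 1 else 0 := by
  refine LinearMap.ext fun f => ?_
  ext x
  have hp : HasFDerivAt (fun x : EuclideanSpace ℝ (Fin n) => ((x j : ℝ) : ℂ))
      (Complex.ofRealCLM ∘L EuclideanSpace.proj (𝕜 := ℝ) j) x :=
    (Complex.ofRealCLM ∘L EuclideanSpace.proj (𝕜 := ℝ) j).hasFDerivAt
  have hm := hp.mul (f.hasFDerivAt x)
  have hc : (⇑(coordMul j f)) = (fun x : EuclideanSpace ℝ (Fin n) => ((x j : ℝ) : ℂ)) * ⇑f := by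
    ext y; simp
  rw [Module.End.mul_apply, coordDeriv_apply, hc, hm.fderiv]
  by_cases h : i = j
  · subst h; simp [coordDeriv_apply]
  · simp [coordDeriv_apply, h, Ne.symm h]

/-- The product of the coordinate multiplications listed in `X`. -/
def mulWord (X : List (Fin n)) : Module.End ℂ 𝓢(EuclideanSpace ℝ (Fin n), ℂ) :=
  (X.map coordMul).prod

/-- The product of the partial derivatives listed in `Y`. -/
def derivWord (Y : List (Fin n)) : Module.End ℂ 𝓢(EuclideanSpace ℝ (Fin n), ℂ) :=
  (Y.map coordDeriv).prod

/-- A coordinate multiplication or a partial derivative. -/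
def letter : Fin n ⊕ Fin n → Module.End ℂ 𝓢(EuclideanSpace ℝ (Fin n), ℂ) :=
  Sum.elim coordMul coordDeriv

/-- The product of the coordinate multiplications and partial derivatives listed in `T`. -/
def word (T : List (Fin n ⊕ Fin n)) : Module.End ℂ 𝓢(EuclideanSpace ℝ (Fin n), ℂ) :=
  (T.map letter).prod

theorem word_cons (a : Fin n ⊕ Fin n) (T : List (Fin n ⊕ Fin n))
    (f : 𝓢(EuclideanSpace ℝ (Fin n), ℂ)) : word (a :: T) f = letter a (word T f) := by
  simp [word]

theorem word_append_singleton (a : Fin n ⊕ Fin n) (T : List (Fin n ⊕ Fin n))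
    (f : 𝓢(EuclideanSpace ℝ (Fin n), ℂ)) : word (T ++ [a]) f = word T (letter a f) := by
  simp [word]

theorem word_inl_append_inr (X Y : List (Fin n)) :
    word (X.map Sum.inl ++ Y.map Sum.inr) = mulWord X * derivWord Y := by
  simp [word, mulWord, derivWord, letter, Function.comp_def]

theorem mulWord_apply (X : List (Fin n)) (f : 𝓢(EuclideanSpace ℝ (Fin n), ℂ))
    (x : EuclideanSpace ℝ (Fin n)) : mulWord X f x = ((X.map fun i => x i).prod : ℝ) * f x := by
  induction X with
  | nil => simp [mulWord]
  | cons i X ih =>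
    have : mulWord (i :: X) f = coordMul i (mulWord X f) := by simp [mulWord]
    rw [this, coordMul_apply, ih]
    simp [mul_assoc]

/-- Leibniz rule: each occurrence of j in Y contributes one copy of Y with that occurrence deleted.
Only the number and the lengths of these words matter for the estimates. -/
theorem derivWord_mul_coordMul (Y : List (Fin n)) (j : Fin n) :
    ∃ Z : List (List (Fin n)), Z.length ≤ Y.length ∧ (∀ z ∈ Z, z.length + 1 = Y.length) ∧
      derivWord Y * coordMul j = coordMul j * derivWord Y + (Z.map derivWord).sum := by
  induction Y with
  | nil => exact ⟨[], by simp [derivWord]⟩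
  | cons i Y ih =>
    obtain ⟨Z, h1, h2, h3⟩ := ih
    have hc : ∀ Y : List (Fin n), derivWord (i :: Y) = coordDeriv i * derivWord Y := by
      simp [derivWord]
    have hs : coordDeriv i * (Z.map derivWord).sum =
        ((Z.map (List.cons i)).map derivWord).sum := by
      rw [← List.sum_map_mul_left]
      simp [hc, Function.comp_def]
    have key : derivWord (i :: Y) * coordMul j = coordMul j * derivWord (i :: Y) +
        ((if i = j then 1 else 0) * derivWord Y + ((Z.map (List.cons i)).map derivWord).sum) := by
      rw [hc, mul_assoc, h3, mul_add, hs, ← mul_assoc, coordDeriv_mul_coordMul, add_mul, mul_assoc,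
        add_assoc]
    by_cases h : i = j
    · refine ⟨Y :: Z.map (List.cons i), by simpa using h1, ?_, ?_⟩
      · simpa using h2
      · rw [key]; simp [h]
    · refine ⟨Z.map (List.cons i), by simp; omega, ?_, ?_⟩
      · simpa using h2
      · rw [key]; simp [h]

/-! ### Dictionary between multi-indices and lists of indices. -/

/-- The list in which the index `i` occurs `α i` times. -/
def multiList (α : Fin n → ℕ) : List (Fin n) :=
  (List.finRange n).flatMap fun i => List.replicate (α i) i

theorem length_multiList (α : Fin n → ℕ) : (multiList α).length = multiLength α := by
  simp [multiList, multiLength, List.length_flatMap, Fin.sum_univ_def]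

theorem count_multiList (α : Fin n → ℕ) (i : Fin n) : (multiList α).count i = α i := by
  simp only [multiList, List.count_flatMap, Function.comp_def, List.count_replicate]
  rw [← Fin.sum_univ_def]
  simp

theorem multiList_count_perm (Y : List (Fin n)) : (multiList fun i => Y.count i).Perm Y :=
  List.perm_iff_count.2 fun i => count_multiList _ i

theorem multiDeriv_eq (β : Fin n → ℕ) (f : 𝓢(EuclideanSpace ℝ (Fin n), ℂ)) :
    multiDeriv β f = derivWord (multiList β) f := by
  unfold multiDeriv multiList
  induction List.finRange n with
  | nil => simp [derivWord]
  | cons i L ih =>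
    rw [List.foldr_cons, ih]
    have : derivWord ((i :: L).flatMap fun i => List.replicate (β i) i) =
        coordDeriv i ^ β i * derivWord (L.flatMap fun i => List.replicate (β i) i) := by
      simp [derivWord]
    rw [this, Module.End.mul_apply, Module.End.pow_apply]
    rfl

theorem monomial_eq (α : Fin n → ℕ) (x : EuclideanSpace ℝ (Fin n)) :
    monomial α x = ((multiList α).map fun i => x i).prod := by
  unfold monomial multiList
  rw [Fin.prod_univ_def]
  induction List.finRange n with
  | nil => simp
  | cons i L ih => simp [ih]

theorem derivWord_perm {Y Z : List (Fin n)} (h : Y.Perm Z) : derivWord Y = derivWord Z := by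
  refine (h.map coordDeriv).prod_eq' ?_
  rw [List.pairwise_map]
  exact List.pairwise_of_forall fun i j => commute_coordDeriv i j

theorem mulWord_multiList_mul_derivWord_multiList (α β : Fin n → ℕ)
    (f : 𝓢(EuclideanSpace ℝ (Fin n), ℂ)) (x : EuclideanSpace ℝ (Fin n)) :
    (mulWord (multiList α) * derivWord (multiList β)) f x =
      (monomial α x : ℂ) * multiDeriv β f x := by
  rw [Module.End.mul_apply, mulWord_apply, monomial_eq, multiDeriv_eq]

theorem mulWord_mul_derivWord_apply (X Y : List (Fin n))
    (f : 𝓢(EuclideanSpace ℝ (Fin n), ℂ)) (x : EuclideanSpace ℝ (Fin n)) :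
    (mulWord X * derivWord Y) f x =
      (monomial (fun i => X.count i) x : ℂ) * multiDeriv (fun i => Y.count i) f x := by
  rw [Module.End.mul_apply, mulWord_apply, monomial_eq, multiDeriv_eq,
    derivWord_perm (multiList_count_perm Y),
    ((multiList_count_perm X).map fun i => x i).prod_eq]

theorem multiLength_count (X : List (Fin n)) : multiLength (fun i => X.count i) = X.length := by
  rw [← length_multiList]
  exact (multiList_count_perm X).length_eq

/-! ### From normally ordered products to arbitrary words, and back. -/

/-- The letters of T are absorbed one at a time into the normally ordered prefix. A derivative is
appended to Y at no cost. A coordinate must cross Y, which leaves at most |Y| commutator terms of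
total length m, two less than before; `hwκ` trades these for a factor κ. Letting κ depend on the
number N of letters still to be absorbed is what makes the sharper count for s = 1 possible. -/
theorem norm_word_le {f : 𝓢(EuclideanSpace ℝ (Fin n), ℂ)} {c : ℝ} {w κ : ℕ → ℝ} (hc : 0 ≤ c)
    (hw : ∀ m, 0 ≤ w m) (hκ : ∀ m, 0 ≤ κ m)
    (hwκ : ∀ N m : ℕ, N ≤ m → (m + 1 : ℝ) * w m ≤ κ N * w (m + 2))
    (hf : ∀ (X Y : List (Fin n)) (x : EuclideanSpace ℝ (Fin n)),
      ‖(mulWord X * derivWord Y) f x‖ ≤ c * w (X.length + Y.length))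
    (T : List (Fin n ⊕ Fin n)) : ∀ (X Y : List (Fin n)) (x : EuclideanSpace ℝ (Fin n)),
    ‖(mulWord X * derivWord Y) (word T f) x‖ ≤
      c * (∏ i ∈ Finset.range T.length, (1 + κ i)) * w (X.length + Y.length + T.length) := by
  induction T with
  | nil => simpa [word] using hf
  | cons a T ih =>
    intro X Y x
    have hp : 0 ≤ c * ∏ i ∈ Finset.range T.length, (1 + κ i) :=
      mul_nonneg hc (Finset.prod_nonneg fun i _ => by linarith [hκ i])
    rw [List.length_cons, Finset.prod_range_succ, word_cons]
    set p := ∏ i ∈ Finset.range T.length, (1 + κ i)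
    rcases a with j | j
    · obtain ⟨Z, h1, h2, h3⟩ := derivWord_mul_coordMul Y j
      have e1 : (mulWord X * derivWord Y) (letter (Sum.inl j) (word T f)) =
          (mulWord (X ++ [j]) * derivWord Y) (word T f) +
            (Z.map fun z => (mulWord X * derivWord z) (word T f)).sum := by
        have : mulWord X * derivWord Y * coordMul j = mulWord (X ++ [j]) * derivWord Y +
            (Z.map fun z => mulWord X * derivWord z).sum := by
          rw [mul_assoc, h3, mul_add, ← List.sum_map_mul_left]
          simp [mulWord, mul_assoc]
        change (mulWord X * derivWord Y * coordMul j) (word T f) = _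
        rw [this, LinearMap.add_apply]
        congr 1
        clear h1 h2 h3 this
        induction Z with
        | nil => simp
        | cons z Z ihZ => simp [ihZ]
      have e2 : ∀ Z : List (List (Fin n)), (∀ z ∈ Z, z.length + 1 = Y.length) →
          ‖(Z.map fun z => (mulWord X * derivWord z) (word T f)).sum x‖ ≤
            Z.length * (c * p * w (X.length + (Y.length - 1) + T.length)) := by
        intro Z hZ
        induction Z with
        | nil => simp
        | cons z Z ihZ =>
          have a1 := ihZ fun y hy => hZ y (List.mem_cons_of_mem _ hy)
          have a2 := ih X z x
          have a3 : z.length = Y.length - 1 := by have := hZ z (by simp); omega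
          rw [a3] at a2
          rw [List.map_cons, List.sum_cons, add_apply, List.length_cons]
          refine (norm_add_le _ _).trans ?_
          push_cast
          linarith
      have e3 := ih (X ++ [j]) Y x
      have e4 := e2 Z h2
      rw [List.length_append, List.length_singleton] at e3
      have e5 : (Z.length : ℝ) * w (X.length + (Y.length - 1) + T.length) ≤
          κ T.length * w (X.length + Y.length + (T.length + 1)) := by
        -- The subtraction in `Y.length - 1` truncates when Y is empty, but then there are no
        -- commutator terms.
        rcases Nat.eq_zero_or_pos Y.length with h0 | h0
        · have : Z.length = 0 := by omega
          rw [this]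
          simpa using mul_nonneg (hκ _) (hw _)
        · have h5 := hwκ T.length (X.length + (Y.length - 1) + T.length) (by omega)
          have h6 : X.length + (Y.length - 1) + T.length + 2 =
            X.length + Y.length + (T.length + 1) := by omega
          rw [h6] at h5
          refine le_trans (mul_le_mul_of_nonneg_right ?_ (hw _)) h5
          have : Z.length ≤ X.length + (Y.length - 1) + T.length + 1 := h1.trans (by omega)
          exact_mod_cast this
      have e6 : X.length + 1 + Y.length + T.length = X.length + Y.length + (T.length + 1) := by
        ring
      rw [e6] at e3
      rw [e1, add_apply]
      refine (norm_add_le _ _).trans ?_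
      have e7 := mul_le_mul_of_nonneg_left e5 hp
      linarith
    · have e1 : (mulWord X * derivWord Y) (letter (Sum.inr j) (word T f)) =
          (mulWord X * derivWord (Y ++ [j])) (word T f) := by
        simp [derivWord, letter]
      rw [e1]
      refine (ih X (Y ++ [j]) x).trans ?_
      have e6 : X.length + (Y ++ [j]).length + T.length =
          X.length + Y.length + (T.length + 1) := by
        simp; ring
      rw [e6]
      have := mul_nonneg (mul_nonneg hp (hκ T.length)) (hw (X.length + Y.length + (T.length + 1)))
      linarith

/-- The bound `|T f| ≲ A^N (N!)^s` for all products `T` of `N` coordinate multiplications and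
partial derivatives. -/
def WordBound (s A : ℝ) (f : 𝓢(EuclideanSpace ℝ (Fin n), ℂ)) : Prop :=
  ∃ c : ℝ, 0 ≤ c ∧ ∀ (T : List (Fin n ⊕ Fin n)) (x : EuclideanSpace ℝ (Fin n)),
    ‖word T f x‖ ≤ c * (A ^ T.length * (T.length.factorial : ℝ) ^ s)

theorem multiFactorial_le (α : Fin n → ℕ) : multiFactorial α ≤ (multiLength α).factorial :=
  Nat.le_of_dvd (Nat.factorial_pos _) (Nat.prod_factorial_dvd_factorial_sum _ _)

theorem WordBound.mono {s A A' : ℝ} (hA : 0 ≤ A) (hAA : A ≤ A')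
    {f : 𝓢(EuclideanSpace ℝ (Fin n), ℂ)} (hf : WordBound s A f) : WordBound s A' f := by
  obtain ⟨c, hc, h⟩ := hf
  refine ⟨c, hc, fun T x => (h T x).trans ?_⟩
  gcongr

theorem norm_le_sum_norm_coord (x : EuclideanSpace ℝ (Fin n)) : ‖x‖ ≤ ∑ i, ‖x i‖ := by
  have hx := (EuclideanSpace.basisFun (Fin n) ℝ).sum_repr x
  conv_lhs => rw [← hx]
  refine (norm_sum_le _ _).trans (le_of_eq (Finset.sum_congr rfl fun i _ => ?_))
  rw [norm_smul]
  simp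

/-- The multinomial coefficient |α|!/α! is one term in the expansion of (1 + ⋯ + 1)^|α| = n^|α|. -/
theorem factorial_multiLength_le (α : Fin n → ℕ) :
    (multiLength α).factorial ≤ n ^ multiLength α * multiFactorial α := by
  have h1 := Nat.multinomial_spec Finset.univ α
  have h2 : Nat.multinomial Finset.univ α ≤ n ^ multiLength α := by
    have h := Finset.sum_pow_eq_sum_piAntidiag (Finset.univ : Finset (Fin n)) (fun _ => (1 : ℕ))
      (multiLength α)
    simp only [Finset.sum_const, Finset.card_univ, Fintype.card_fin, smul_eq_mul, mul_one, one_pow,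
      Finset.prod_const_one, Nat.cast_id] at h
    rw [h]
    exact Finset.single_le_sum (f := fun k => Nat.multinomial Finset.univ k)
      (fun _ _ => Nat.zero_le _) (by simp [multiLength])
  unfold multiLength multiFactorial at *
  rw [← h1, mul_comm]
  exact Nat.mul_le_mul_right _ h2

theorem factorial_add_le (a b : ℕ) :
    (a + b).factorial ≤ 2 ^ (a + b) * (a.factorial * b.factorial) := by
  rw [← Nat.add_choose_mul_factorial_mul_factorial, mul_assoc]
  exact Nat.mul_le_mul_right _ (Nat.choose_le_two_pow _ _)

theorem norm_mulWord_mul_derivWord_le {s A : ℝ} (hs : 0 ≤ s) (hA : 0 < A)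
    {f : 𝓢(EuclideanSpace ℝ (Fin n), ℂ)} (hf : Estimate s s A A f) :
    ∃ c : ℝ, 0 ≤ c ∧ ∀ (X Y : List (Fin n)) (x : EuclideanSpace ℝ (Fin n)),
      ‖(mulWord X * derivWord Y) f x‖ ≤
        c * (A ^ (X.length + Y.length) * ((X.length + Y.length).factorial : ℝ) ^ s) := by
  obtain ⟨c, hc, h⟩ := hf
  refine ⟨c, hc.le, fun X Y x => ?_⟩
  rw [mulWord_mul_derivWord_apply]
  refine (h _ _ x).trans ?_
  rw [multiLength_count, multiLength_count, ← pow_add, mul_assoc,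
    ← Real.mul_rpow (Nat.cast_nonneg _) (Nat.cast_nonneg _), ← Nat.cast_mul]
  have h1 := multiFactorial_le fun i => X.count i
  have h2 := multiFactorial_le fun i => Y.count i
  rw [multiLength_count] at h1 h2
  have h3 := Nat.le_of_dvd (Nat.factorial_pos _)
    (Nat.factorial_mul_factorial_dvd_factorial_add X.length Y.length)
  have h4 := (Nat.mul_le_mul h1 h2).trans h3
  gcongr

theorem Estimate.mono {s r A B A' B' : ℝ} (hA : 0 ≤ A) (hB : 0 ≤ B) (hAA : A ≤ A') (hBB : B ≤ B')
    {f : 𝓢(EuclideanSpace ℝ (Fin n), ℂ)} (hf : Estimate s r A B f) : Estimate s r A' B' f := by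
  obtain ⟨c, hc, h⟩ := hf
  refine ⟨c, hc, fun α β x => (h α β x).trans ?_⟩
  have : 0 ≤ A' := hA.trans hAA
  gcongr

/-- Specialises the weight to w(m) = A^m (m!)^s; dividing by w(m) turns the weight condition into an
inequality free of factorials. -/
theorem wordBound_of_le {s A R : ℝ} {κ : ℕ → ℝ} (hs : 0 ≤ s) (hA : 0 < A)
    {f : 𝓢(EuclideanSpace ℝ (Fin n), ℂ)} (hf : Estimate s s A A f) (hκ : ∀ m, 0 ≤ κ m)
    (hwκ : ∀ N m : ℕ, N ≤ m →
      (m + 1 : ℝ) ≤ κ N * A ^ 2 * (((m + 2 : ℝ) * (m + 1)) ^ s))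
    (hR : ∃ C : ℝ, 0 ≤ C ∧ ∀ N : ℕ, ∏ i ∈ Finset.range N, (1 + κ i) ≤ C * R ^ N) :
    WordBound s (R * A) f := by
  obtain ⟨c, hc, h⟩ := norm_mulWord_mul_derivWord_le hs hA hf
  obtain ⟨C, hC, hR⟩ := hR
  refine ⟨c * C, mul_nonneg hc hC, fun T x => ?_⟩
  have key := norm_word_le (w := fun m => A ^ m * (m.factorial : ℝ) ^ s) hc
    (fun m => by positivity) hκ ?_ h T [] [] x
  · have e : (mulWord ([] : List (Fin n)) * derivWord ([] : List (Fin n))) (word T f) =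
        word T f := by
      simp [mulWord, derivWord]
    rw [e] at key
    refine key.trans ?_
    simp only [List.length_nil, Nat.zero_add]
    have := mul_le_mul_of_nonneg_left (hR T.length) hc
    have h2 : 0 ≤ A ^ T.length * (T.length.factorial : ℝ) ^ s := by positivity
    have := mul_le_mul_of_nonneg_right this h2
    rw [mul_pow]
    linarith
  · intro N m hNm
    have e : ((m + 2).factorial : ℝ) ^ s =
        ((m + 2 : ℝ) * (m + 1)) ^ s * (m.factorial : ℝ) ^ s := by
      rw [← Real.mul_rpow (by positivity) (by positivity)]
      congr 1
      rw [Nat.factorial_succ, Nat.factorial_succ]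
      push_cast
      ring
    have h1 := hwκ N m hNm
    have h2 : 0 ≤ A ^ m * (m.factorial : ℝ) ^ s := by positivity
    have h3 := mul_le_mul_of_nonneg_right h1 h2
    rw [e, pow_add]
    linarith

theorem exists_wordBound {s A B : ℝ} (hs : 1 / 2 ≤ s) (hA : 0 < A) (hB : 0 < B)
    {f : 𝓢(EuclideanSpace ℝ (Fin n), ℂ)} (hf : Estimate s s A B f) :
    ∃ A' : ℝ, 0 < A' ∧ WordBound s A' f := by
  set M := max A B
  have hM : 0 < M := lt_max_of_lt_left hA
  have hf' := hf.mono hA.le hB.le (le_max_left A B) (le_max_right A B)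
  -- With κ constant equal to M⁻², the requirement becomes m + 1 ≤ ((m+2)(m+1))^s, which is where s
  -- ≥ 1/2 enters. The resulting constant M + 1/M does not tend to 0 with M.
  refine ⟨(1 + (M ^ 2)⁻¹) * M, by positivity,
    wordBound_of_le (κ := fun _ => (M ^ 2)⁻¹) (by linarith) hM hf' (fun _ => by positivity) ?_
      ⟨1, zero_le_one, fun N => by simp⟩⟩
  intro N m _
  rw [inv_mul_cancel₀ (by positivity), one_mul]
  have h1 : (1 : ℝ) ≤ m + 1 := by simp
  calc (m + 1 : ℝ) = ((m + 1 : ℝ) ^ (2 : ℝ)) ^ (1 / 2 : ℝ) := by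
        rw [← Real.rpow_mul (by positivity)]; norm_num
    _ ≤ ((m + 2 : ℝ) * (m + 1)) ^ (1 / 2 : ℝ) := by
        refine Real.rpow_le_rpow (by positivity) ?_ (by norm_num)
        rw [Real.rpow_two]
        nlinarith
    _ ≤ _ := Real.rpow_le_rpow_of_exponent_le (by nlinarith) hs

/-- The product telescopes to the binomial coefficient C(N+K, K), so its exponential rate in N does
not depend on K. -/
theorem prod_one_add_div_le (K N : ℕ) :
    ∏ i ∈ Finset.range N, (1 + (K : ℝ) / (i + 1)) ≤ 2 ^ K * 2 ^ N := by
  have h : ∏ i ∈ Finset.range N, (1 + (K : ℝ) / (i + 1)) = ((N + K).choose K : ℕ) := by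
    induction N with
    | zero => simp
    | succ N ih =>
      rw [Finset.prod_range_succ, ih]
      have h1 := Nat.add_one_mul_choose_eq (N + K) K
      have h2 := Nat.choose_symm_add (a := N) (b := K)
      have h3 : (N + 1 + K) * (N + K).choose K = (N + 1 + K).choose K * (N + 1) := by
        have h4 := Nat.add_one_mul_choose_eq (N + K) N
        rw [Nat.choose_symm_add] at h4
        have h5 : (N + K + 1).choose (N + 1) = (N + 1 + K).choose K := by
          rw [show N + K + 1 = N + 1 + K by ring, Nat.choose_symm_add]
        rw [h5] at h4
        rw [← h4]; ring
      have h6 : ((N : ℝ) + 1 + K) * ((N + K).choose K : ℕ) =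
          ((N + 1 + K).choose K : ℕ) * ((N : ℝ) + 1) := by exact_mod_cast h3
      field_simp
      linarith
  rw [h, ← pow_add, add_comm K N]
  exact_mod_cast Nat.choose_le_two_pow _ _

/-- For s = 1 the weight gains a full factor (m+2)(m+1) against a loss of m+1, so the spare m+2 ≥
N+1 allows κ_N = K/(N+1) with K ≥ A⁻². The size of K then affects only the implicit constant, and
the rate stays proportional to A. -/
theorem wordBound_one {f : 𝓢(EuclideanSpace ℝ (Fin n), ℂ)} {A : ℝ} (hA : 0 < A)
    (hf : Estimate 1 1 A A f) : WordBound 1 (2 * A) f := by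
  set K := ⌈(A ^ 2)⁻¹⌉₊
  have hK : (A ^ 2)⁻¹ ≤ K := Nat.le_ceil _
  refine wordBound_of_le (κ := fun i => (K : ℝ) / (i + 1)) zero_le_one hA hf
    (fun _ => by positivity) ?_ ⟨2 ^ K, by positivity, prod_one_add_div_le K⟩
  intro N m hNm
  rw [Real.rpow_one]
  have h1 : 1 ≤ K * A ^ 2 := by
    rwa [inv_le_iff_one_le_mul₀ (by positivity)] at hK
  have h2 : (N : ℝ) + 1 ≤ m + 2 := by
    have : (N : ℝ) ≤ m := by exact_mod_cast hNm
    linarith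
  have h3 : 1 ≤ (m + 2 : ℝ) / (N + 1) := by rwa [one_le_div (by positivity)]
  calc (m + 1 : ℝ) = 1 * 1 * (m + 1) := by ring
    _ ≤ (K * A ^ 2) * ((m + 2 : ℝ) / (N + 1)) * (m + 1) := by gcongr
    _ = _ := by ring

theorem WordBound.estimate {s A : ℝ} (hs : 0 ≤ s) (hA : 0 < A)
    {f : 𝓢(EuclideanSpace ℝ (Fin n), ℂ)} (hf : WordBound s A f) :
    Estimate s s ((2 * (n + 1) : ℝ) ^ s * A) ((2 * (n + 1) : ℝ) ^ s * A) f := by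
  obtain ⟨c, hc, h⟩ := hf
  refine ⟨c + 1, by positivity, fun α β x => ?_⟩
  have h1 := h ((multiList α).map Sum.inl ++ (multiList β).map Sum.inr) x
  rw [word_inl_append_inr, mulWord_multiList_mul_derivWord_multiList, List.length_append,
    List.length_map, List.length_map, length_multiList, length_multiList] at h1
  refine h1.trans ?_
  set a := multiLength α with ha
  set b := multiLength β with hb
  have h2 : ((a + b).factorial : ℝ) ≤
      (2 * (n + 1) : ℝ) ^ (a + b) * (multiFactorial α * multiFactorial β) := by
    have h3 := factorial_add_le a b
    have h4 := factorial_multiLength_le α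
    have h5 := factorial_multiLength_le β
    have h6 : (a + b).factorial ≤
        -- Using n + 1 instead of n keeps the final constant positive when n = 0.
        2 ^ (a + b) * (((n + 1) ^ a * multiFactorial α) * ((n + 1) ^ b * multiFactorial β)) := by
      refine h3.trans (Nat.mul_le_mul_left _ (Nat.mul_le_mul (h4.trans ?_) (h5.trans ?_))) <;>
      · gcongr
        omega
    have h7 : ((a + b).factorial : ℝ) ≤ 2 ^ (a + b) *
        ((((n : ℝ) + 1) ^ a * multiFactorial α) * (((n : ℝ) + 1) ^ b * multiFactorial β)) := by
      exact_mod_cast h6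
    refine h7.trans (le_of_eq ?_)
    rw [mul_pow, pow_add ((n : ℝ) + 1)]
    ring
  have h8 : ((a + b).factorial : ℝ) ^ s ≤ ((2 * (n + 1) : ℝ) ^ s) ^ (a + b) *
      ((multiFactorial α : ℝ) ^ s * (multiFactorial β : ℝ) ^ s) := by
    refine (Real.rpow_le_rpow (Nat.cast_nonneg _) h2 hs).trans (le_of_eq ?_)
    rw [Real.mul_rpow (by positivity) (by positivity),
      Real.mul_rpow (Nat.cast_nonneg _) (Nat.cast_nonneg _), ← Real.rpow_natCast,
      ← Real.rpow_mul (by positivity), ← Real.rpow_natCast, ← Real.rpow_mul (by positivity),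
      mul_comm s]
  calc c * (A ^ (a + b) * ((a + b).factorial : ℝ) ^ s)
      ≤ (c + 1) * (A ^ (a + b) * (((2 * (n + 1) : ℝ) ^ s) ^ (a + b) *
      ((multiFactorial α : ℝ) ^ s * (multiFactorial β : ℝ) ^ s))) := by gcongr; linarith
    _ = _ := by rw [mul_pow, mul_pow, pow_add, pow_add]; ring

/-- Since ‖x‖ ≤ ∑ |x_i| and each x_i merely prefixes a letter to the word, one more power of the
weight lengthens words by one. The extra factor (N+1)^s is at most (2^s)^N, so the rate stays a
multiple of A. -/
theorem WordBound.one_add_norm_pow {s : ℝ} (hs : 0 ≤ s) (k : ℕ) :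
    ∀ {A : ℝ} {f : 𝓢(EuclideanSpace ℝ (Fin n), ℂ)}, 0 < A → WordBound s A f →
    ∃ c : ℝ, 0 ≤ c ∧ ∀ (T : List (Fin n ⊕ Fin n)) (x : EuclideanSpace ℝ (Fin n)),
      (1 + ‖x‖) ^ k * ‖word T f x‖ ≤
        c * ((((2 : ℝ) ^ s) ^ k * A) ^ T.length * (T.length.factorial : ℝ) ^ s) := by
  induction k with
  | zero => intro A f hA hf; simpa [WordBound] using hf
  | succ k ih =>
    intro A f hA hf
    obtain ⟨c, hc, h⟩ := ih hA hf
    set D := ((2 : ℝ) ^ s) ^ k * A with hD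
    have hD0 : 0 < D := by positivity
    have h2 : (1 : ℝ) ≤ 2 ^ s := Real.one_le_rpow (by norm_num) hs
    refine ⟨c * (1 + n * D), by positivity, fun T x => ?_⟩
    have hn := norm_le_sum_norm_coord x
    have e1 : ∀ i, ‖x i‖ * ((1 + ‖x‖) ^ k * ‖word T f x‖) ≤
        c * (D ^ (T.length + 1) * ((T.length + 1).factorial : ℝ) ^ s) := by
      intro i
      have := h (Sum.inl i :: T) x
      rw [word_cons, List.length_cons] at this
      simp only [letter, Sum.elim_inl, coordMul_apply, norm_mul, Complex.norm_real] at this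
      linarith
    have e2 : ((T.length + 1).factorial : ℝ) ^ s ≤
        ((2 : ℝ) ^ s) ^ T.length * (T.length.factorial : ℝ) ^ s := by
      rw [← Real.rpow_natCast, ← Real.rpow_mul (by positivity), mul_comm s,
        Real.rpow_mul (by positivity), Real.rpow_natCast,
        ← Real.mul_rpow (by positivity) (by positivity)]
      refine Real.rpow_le_rpow (by positivity) ?_ hs
      rw [Nat.factorial_succ]
      have : T.length + 1 ≤ 2 ^ T.length := Nat.lt_two_pow_self
      exact_mod_cast Nat.mul_le_mul_right _ this
    have e3 : (1 : ℝ) ≤ ((2 : ℝ) ^ s) ^ T.length := one_le_pow₀ h2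
    calc (1 + ‖x‖) ^ (k + 1) * ‖word T f x‖
        = (1 + ‖x‖) * ((1 + ‖x‖) ^ k * ‖word T f x‖) := by ring
      _ ≤ (1 + ∑ i, ‖x i‖) * ((1 + ‖x‖) ^ k * ‖word T f x‖) := by gcongr
      _ = (1 + ‖x‖) ^ k * ‖word T f x‖ + ∑ i, ‖x i‖ * ((1 + ‖x‖) ^ k * ‖word T f x‖) := by
          rw [add_mul, one_mul, Finset.sum_mul]
      _ ≤ c * (D ^ T.length * (T.length.factorial : ℝ) ^ s) +
          ∑ _i : Fin n, c * (D ^ (T.length + 1) * ((T.length + 1).factorial : ℝ) ^ s) :=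
          add_le_add (h T x) (Finset.sum_le_sum fun i _ => e1 i)
      _ = c * (D ^ T.length * (1 * (T.length.factorial : ℝ) ^ s)) +
          n * (c * (D ^ (T.length + 1) * ((T.length + 1).factorial : ℝ) ^ s)) := by simp
      _ ≤ c * (D ^ T.length * (((2 : ℝ) ^ s) ^ T.length * (T.length.factorial : ℝ) ^ s)) +
          n * (c * (D ^ (T.length + 1) *
            (((2 : ℝ) ^ s) ^ T.length * (T.length.factorial : ℝ) ^ s))) := by gcongr
      _ = _ := by
          rw [show ((2 : ℝ) ^ s) ^ (k + 1) * A = 2 ^ s * D by rw [hD]; ring, mul_pow]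
          ring

end

/-! ### The integrand of the cross-Wigner distribution: decay and derivatives. -/

section

variable {d : ℕ}

/-- `position` as a continuous linear map. -/
def positionL : EuclideanSpace ℝ (Fin (d + d)) →L[ℝ] EuclideanSpace ℝ (Fin d) :=
  LinearMap.toContinuousLinearMap
    { toFun := position, map_add' := fun _ _ => rfl, map_smul' := fun _ _ => rfl }

/-- `frequency` as a continuous linear map. -/
def frequencyL : EuclideanSpace ℝ (Fin (d + d)) →L[ℝ] EuclideanSpace ℝ (Fin d) :=
  LinearMap.toContinuousLinearMap
    { toFun := frequency, map_add' := fun _ _ => rfl, map_smul' := fun _ _ => rfl }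

@[simp]
theorem positionL_apply (z : EuclideanSpace ℝ (Fin (d + d))) : positionL z = position z := rfl

@[simp]
theorem frequencyL_apply (z : EuclideanSpace ℝ (Fin (d + d))) : frequencyL z = frequency z := rfl

theorem position_single_castAdd (j : Fin d) :
    position (EuclideanSpace.single (Fin.castAdd d j) (1 : ℝ)) = EuclideanSpace.single j 1 := by
  ext i; simp [position]

theorem position_single_natAdd (j : Fin d) :
    position (EuclideanSpace.single (Fin.natAdd d j) (1 : ℝ)) = 0 := by
  ext i; simp [position]
  intro h; simp [Fin.ext_iff] at h; omega

theorem frequency_single_castAdd (j : Fin d) :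
    frequency (EuclideanSpace.single (Fin.castAdd d j) (1 : ℝ)) = 0 := by
  ext i; simp [frequency]
  intro h; simp [Fin.ext_iff] at h; omega

theorem frequency_single_natAdd (j : Fin d) :
    frequency (EuclideanSpace.single (Fin.natAdd d j) (1 : ℝ)) = EuclideanSpace.single j 1 := by
  ext i; simp [frequency]

/-- The product `f(x + t/2) conj(g(x - t/2))`. -/
def shiftMul (f g : EuclideanSpace ℝ (Fin d) → ℂ) (x t : EuclideanSpace ℝ (Fin d)) : ℂ :=
  f (x + (1 / 2 : ℝ) • t) * (starRingEnd ℂ) (g (x - (1 / 2 : ℝ) • t))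

/-- The character `e^(-2πi t·ξ)`. -/
def character (t ξ : EuclideanSpace ℝ (Fin d)) : ℂ :=
  Complex.exp (-2 * Real.pi * Complex.I * (inner ℝ t ξ : ℝ))

/-- The integrand of the cross-Wigner distribution. -/
def wignerKernel (f g : EuclideanSpace ℝ (Fin d) → ℂ) (z : EuclideanSpace ℝ (Fin (d + d)))
    (t : EuclideanSpace ℝ (Fin d)) : ℂ :=
  shiftMul f g (position z) t * character t (frequency z)

theorem crossWigner_eq (f g : EuclideanSpace ℝ (Fin d) → ℂ)
    (z : EuclideanSpace ℝ (Fin (d + d))) : crossWigner f g z = ∫ t, wignerKernel f g z t := rfl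

theorem norm_character (t ξ : EuclideanSpace ℝ (Fin d)) : ‖character t ξ‖ = 1 := by
  unfold character
  have : (-2 * Real.pi * Complex.I * (inner ℝ t ξ : ℝ) : ℂ) =
      ((-2 * Real.pi * inner ℝ t ξ : ℝ) : ℂ) * Complex.I := by push_cast; ring
  rw [this, Complex.norm_exp_ofReal_mul_I]

/-- With u = x + t/2 and v = x - t/2 one has t = u - v, hence 1 + ‖t‖ ≤ (1 + ‖u‖)(1 + ‖v‖). Decay of
f and g thus gives decay in t, uniformly in z. -/
theorem norm_wignerKernel_le {f g : EuclideanSpace ℝ (Fin d) → ℂ} {k : ℕ} {P Q : ℝ}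
    (hf : ∀ x, (1 + ‖x‖) ^ k * ‖f x‖ ≤ P) (hg : ∀ x, (1 + ‖x‖) ^ k * ‖g x‖ ≤ Q)
    (z : EuclideanSpace ℝ (Fin (d + d))) (t : EuclideanSpace ℝ (Fin d)) :
    ‖wignerKernel f g z t‖ ≤ P * Q * ((1 + ‖t‖) ^ k)⁻¹ := by
  rw [wignerKernel, shiftMul, norm_mul, norm_character, mul_one, norm_mul, RCLike.norm_conj]
  set u := position z + (1 / 2 : ℝ) • t
  set v := position z - (1 / 2 : ℝ) • t
  have ht : t = u - v := by
    simp only [u, v]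
    rw [add_sub_sub_cancel, ← add_smul]
    norm_num
  have h1 : 1 + ‖t‖ ≤ (1 + ‖u‖) * (1 + ‖v‖) := by
    have := norm_sub_le u v
    rw [← ht] at this
    nlinarith [mul_nonneg (norm_nonneg u) (norm_nonneg v)]
  rw [← div_eq_mul_inv, le_div_iff₀ (by positivity)]
  calc ‖f u‖ * ‖g v‖ * (1 + ‖t‖) ^ k ≤ ‖f u‖ * ‖g v‖ * ((1 + ‖u‖) * (1 + ‖v‖)) ^ k := by gcongr
    _ = ((1 + ‖u‖) ^ k * ‖f u‖) * ((1 + ‖v‖) ^ k * ‖g v‖) := by rw [mul_pow]; ring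
    _ ≤ P * Q := mul_le_mul (hf u) (hg v) (by positivity) (le_trans (by positivity) (hf u))

theorem integrable_one_add_norm_pow :
    MeasureTheory.Integrable fun t : EuclideanSpace ℝ (Fin d) => ((1 + ‖t‖) ^ (d + 1))⁻¹ := by
  have h := integrable_one_add_norm (E := EuclideanSpace ℝ (Fin d))
    (μ := MeasureTheory.volume) (r := ((d + 1 : ℕ) : ℝ)) (by simp)
  refine h.congr (Filter.Eventually.of_forall fun t => ?_)
  simp only
  rw [Real.rpow_neg (by positivity), Real.rpow_natCast]

theorem exists_one_add_norm_pow_le (f : 𝓢(EuclideanSpace ℝ (Fin d), ℂ)) (k : ℕ) :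
    ∃ P, ∀ x, (1 + ‖x‖) ^ k * ‖f x‖ ≤ P :=
  ⟨_, fun x => by
    simpa using SchwartzMap.one_add_le_sup_seminorm_apply (𝕜 := ℝ) (m := (k, 0)) le_rfl le_rfl f x⟩

theorem exists_norm_wignerKernel_le (f g : 𝓢(EuclideanSpace ℝ (Fin d), ℂ)) :
    ∃ C, ∀ z t, ‖wignerKernel f g z t‖ ≤ C * ((1 + ‖t‖) ^ (d + 1))⁻¹ := by
  obtain ⟨P, hP⟩ := exists_one_add_norm_pow_le f (d + 1)
  obtain ⟨Q, hQ⟩ := exists_one_add_norm_pow_le g (d + 1)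
  exact ⟨P * Q, norm_wignerKernel_le hP hQ⟩

theorem continuous_wignerKernel (f g : 𝓢(EuclideanSpace ℝ (Fin d), ℂ))
    (z : EuclideanSpace ℝ (Fin (d + d))) : Continuous (wignerKernel f g z) := by
  have hf := f.continuous
  have hg := g.continuous
  unfold wignerKernel shiftMul character
  refine Continuous.mul (Continuous.mul (hf.comp (by fun_prop))
    (Complex.continuous_conj.comp (hg.comp (by fun_prop)))) (by fun_prop)

theorem integrable_wignerKernel (f g : 𝓢(EuclideanSpace ℝ (Fin d), ℂ))
    (z : EuclideanSpace ℝ (Fin (d + d))) : MeasureTheory.Integrable (wignerKernel f g z) := by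
  obtain ⟨C, hC⟩ := exists_norm_wignerKernel_le f g
  exact (integrable_one_add_norm_pow.const_mul C).mono'
    (continuous_wignerKernel f g z).aestronglyMeasurable (Filter.Eventually.of_forall (hC z))

theorem norm_crossWigner_le {f g : EuclideanSpace ℝ (Fin d) → ℂ} {P Q : ℝ}
    (hf : ∀ x, (1 + ‖x‖) ^ (d + 1) * ‖f x‖ ≤ P) (hg : ∀ x, (1 + ‖x‖) ^ (d + 1) * ‖g x‖ ≤ Q)
    (z : EuclideanSpace ℝ (Fin (d + d))) :
    ‖crossWigner f g z‖ ≤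
      P * Q * ∫ t : EuclideanSpace ℝ (Fin d), ((1 + ‖t‖) ^ (d + 1))⁻¹ := by
  rw [crossWigner_eq, ← MeasureTheory.integral_const_mul]
  exact MeasureTheory.norm_integral_le_of_norm_le (integrable_one_add_norm_pow.const_mul _)
    (Filter.Eventually.of_forall (norm_wignerKernel_le hf hg z))

theorem hasFDerivAt_conj {E : Type*} [NormedAddCommGroup E] [NormedSpace ℝ E] {g : E → ℂ}
    {g' : E →L[ℝ] ℂ} {x : E} (h : HasFDerivAt g g' x) :
    HasFDerivAt (fun y => (starRingEnd ℂ) (g y)) ((Complex.conjCLE : ℂ →L[ℝ] ℂ) ∘L g') x :=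
  (Complex.conjCLE : ℂ →L[ℝ] ℂ).hasFDerivAt.comp x h

theorem hasFDerivAt_wignerKernel (f g : 𝓢(EuclideanSpace ℝ (Fin d), ℂ))
    (z : EuclideanSpace ℝ (Fin (d + d))) (t : EuclideanSpace ℝ (Fin d)) :
    ∃ L : EuclideanSpace ℝ (Fin (d + d)) →L[ℝ] ℂ,
      HasFDerivAt (fun z => wignerKernel f g z t) L z ∧
      ∀ v, L v = ((fderiv ℝ f (position z + (1 / 2 : ℝ) • t) (position v)) *
            (starRingEnd ℂ) (g (position z - (1 / 2 : ℝ) • t)) +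
          f (position z + (1 / 2 : ℝ) • t) *
            (starRingEnd ℂ) (fderiv ℝ g (position z - (1 / 2 : ℝ) • t) (position v)) +
          shiftMul f g (position z) t *
            (-2 * Real.pi * Complex.I * (inner ℝ t (frequency v) : ℝ))) *
        character t (frequency z) := by
  have hf := (f.hasFDerivAt (position z + (1 / 2 : ℝ) • t)).comp z
    ((positionL (d := d)).hasFDerivAt.add_const ((1 / 2 : ℝ) • t))
  have hg := hasFDerivAt_conj ((g.hasFDerivAt (position z - (1 / 2 : ℝ) • t)).comp z
    ((positionL (d := d)).hasFDerivAt.sub_const ((1 / 2 : ℝ) • t)))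
  have hl := (((Complex.ofRealCLM ∘L (innerSL ℝ t)) ∘L (frequencyL (d := d))).hasFDerivAt
    (x := z)).const_mul (-2 * Real.pi * Complex.I : ℂ)
  refine ⟨_, (hf.mul hg).mul hl.cexp, fun v => ?_⟩
  simp [shiftMul, character]
  ring

theorem hasFDerivAt_shiftMul (f g : 𝓢(EuclideanSpace ℝ (Fin d), ℂ))
    (x t : EuclideanSpace ℝ (Fin d)) :
    ∃ L : EuclideanSpace ℝ (Fin d) →L[ℝ] ℂ,
      HasFDerivAt (fun t => shiftMul f g x t) L t ∧
      ∀ v, L v = (1 / 2 : ℂ) * (fderiv ℝ f (x + (1 / 2 : ℝ) • t) v *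
            (starRingEnd ℂ) (g (x - (1 / 2 : ℝ) • t)) -
          f (x + (1 / 2 : ℝ) • t) * (starRingEnd ℂ) (fderiv ℝ g (x - (1 / 2 : ℝ) • t) v)) := by
  have hl : HasFDerivAt (fun t : EuclideanSpace ℝ (Fin d) => (1 / 2 : ℝ) • t)
    ((1 / 2 : ℝ) • ContinuousLinearMap.id ℝ _) t := (hasFDerivAt_id t).const_smul (1 / 2 : ℝ)
  have hf := (f.hasFDerivAt (x + (1 / 2 : ℝ) • t)).comp t (hl.const_add x)
  have hg := hasFDerivAt_conj ((g.hasFDerivAt (x - (1 / 2 : ℝ) • t)).comp t (hl.const_sub x))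
  refine ⟨_, hf.mul hg, fun v => ?_⟩
  simp
  ring

theorem hasFDerivAt_character (t ξ : EuclideanSpace ℝ (Fin d)) :
    ∃ L : EuclideanSpace ℝ (Fin d) →L[ℝ] ℂ,
      HasFDerivAt (fun t => character t ξ) L t ∧
      ∀ v, L v = character t ξ * (-2 * Real.pi * Complex.I * (inner ℝ v ξ : ℝ)) := by
  have hl := ((Complex.ofRealCLM ∘L (innerSL ℝ ξ)).hasFDerivAt
    (x := t)).const_mul (-2 * Real.pi * Complex.I : ℂ)
  have := hl.cexp
  simp only [ContinuousLinearMap.coe_comp, Function.comp_apply, innerSL_apply_apply,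
    Complex.ofRealCLM_apply] at this
  refine ⟨_, this.congr_of_eventuallyEq (Filter.Eventually.of_forall fun t => ?_), fun v => ?_⟩
  · simp only [character, real_inner_comm]
  · simp [character, real_inner_comm]

/-! ### Intertwining relations for the letters on ℝ^(2d). -/

theorem conj_inv_two : (starRingEnd ℂ) (2⁻¹ : ℂ) = 2⁻¹ := by
  rw [map_inv₀, map_ofNat]

/-- In x_j this is the product rule. In ξ_j the character produces -2πi t_j, and t_j is the
difference of the j-th coordinates of the arguments of f and g. -/
theorem exists_fderiv_wignerKernel (k : Fin (d + d)) : ∃ (c₁ c₂ : ℂ) (b : Fin d ⊕ Fin d),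
    ‖c₁‖ ≤ 2 * Real.pi ∧ ‖c₂‖ ≤ 2 * Real.pi ∧
    ∀ (f g : 𝓢(EuclideanSpace ℝ (Fin d), ℂ)) (z : EuclideanSpace ℝ (Fin (d + d)))
      (t : EuclideanSpace ℝ (Fin d)),
      fderiv ℝ (fun z => wignerKernel f g z t) z (EuclideanSpace.single k 1) =
        c₁ * wignerKernel (letter b f) g z t + c₂ * wignerKernel f (letter b g) z t := by
  have hpi := Real.pi_gt_three
  refine Fin.addCases (fun j => ?_) (fun j => ?_) k
  · refine ⟨1, 1, Sum.inr j, by norm_num; linarith, by norm_num; linarith, fun f g z t => ?_⟩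
    obtain ⟨L, hL, h⟩ := hasFDerivAt_wignerKernel f g z t
    rw [hL.fderiv, h, position_single_castAdd, frequency_single_castAdd]
    simp only [wignerKernel, shiftMul, letter, Sum.elim_inr, coordDeriv_apply, inner_zero_right]
    push_cast
    ring
  · refine ⟨-2 * Real.pi * Complex.I, 2 * Real.pi * Complex.I, Sum.inl j, ?_, ?_,
      fun f g z t => ?_⟩
    · simp [abs_of_pos Real.pi_pos]
    · simp [abs_of_pos Real.pi_pos]
    obtain ⟨L, hL, h⟩ := hasFDerivAt_wignerKernel f g z t
    rw [hL.fderiv, h, position_single_natAdd, frequency_single_natAdd,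
      EuclideanSpace.inner_single_right]
    simp [wignerKernel, shiftMul, letter, -map_inv₀, conj_inv_two]
    ring

/-- The coordinate x_j is the mean of the j-th coordinates of x + t/2 and x - t/2. The coordinate
ξ_j comes from differentiating the character in t_j and integrating by parts; 1/(4πi) combines
1/(2πi) with the factor 1/2 from the chain rule. -/
theorem exists_coord_mul_crossWigner (k : Fin (d + d)) : ∃ (c₁ c₂ : ℂ) (b : Fin d ⊕ Fin d),
    ‖c₁‖ ≤ 2 * Real.pi ∧ ‖c₂‖ ≤ 2 * Real.pi ∧
    ∀ (f g : 𝓢(EuclideanSpace ℝ (Fin d), ℂ)) (z : EuclideanSpace ℝ (Fin (d + d))),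
      (z k : ℂ) * crossWigner f g z =
        c₁ * crossWigner (letter b f) g z + c₂ * crossWigner f (letter b g) z := by
  have hpi := Real.pi_gt_three
  have hadd : ∀ (c₁ c₂ : ℂ) (f₁ g₁ f₂ g₂ : 𝓢(EuclideanSpace ℝ (Fin d), ℂ))
      (z : EuclideanSpace ℝ (Fin (d + d))),
      c₁ * crossWigner f₁ g₁ z + c₂ * crossWigner f₂ g₂ z =
        ∫ t, (c₁ * wignerKernel f₁ g₁ z t + c₂ * wignerKernel f₂ g₂ z t) := by
    intro c₁ c₂ f₁ g₁ f₂ g₂ z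
    rw [MeasureTheory.integral_add ((integrable_wignerKernel f₁ g₁ z).const_mul c₁)
      ((integrable_wignerKernel f₂ g₂ z).const_mul c₂), MeasureTheory.integral_const_mul,
      MeasureTheory.integral_const_mul, crossWigner_eq, crossWigner_eq]
  refine Fin.addCases (fun j => ?_) (fun j => ?_) k
  · refine ⟨1 / 2, 1 / 2, Sum.inl j, by norm_num; linarith, by norm_num; linarith,
      fun f g z => ?_⟩
    rw [hadd, crossWigner_eq, ← MeasureTheory.integral_const_mul]
    congr 1
    ext t
    simp [wignerKernel, shiftMul, letter, position, -map_inv₀, conj_inv_two]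
    ring
  · have hc : ‖(1 / (4 * Real.pi * Complex.I) : ℂ)‖ ≤ 2 * Real.pi := by
      simp only [one_div, norm_inv, norm_mul, Complex.norm_I, Complex.norm_real, Real.norm_eq_abs,
        abs_of_pos Real.pi_pos, Complex.norm_ofNat, mul_one]
      exact (inv_le_one_of_one_le₀ (by linarith)).trans (by linarith)
    refine ⟨1 / (4 * Real.pi * Complex.I), -(1 / (4 * Real.pi * Complex.I)), Sum.inr j, hc,
      by rwa [norm_neg], fun f g z => ?_⟩
    have e1 : ∀ t, fderiv ℝ (fun t => shiftMul f g (position z) t) t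
        (EuclideanSpace.single j 1) * character t (frequency z) =
        (1 / 2) * wignerKernel (letter (Sum.inr j) f) g z t +
          (-(1 / 2)) * wignerKernel f (letter (Sum.inr j) g) z t := by
      intro t
      obtain ⟨L, hL, h⟩ := hasFDerivAt_shiftMul f g (position z) t
      rw [hL.fderiv, h]
      simp only [wignerKernel, shiftMul, letter, Sum.elim_inr, coordDeriv_apply]
      ring
    have e2 : ∀ t, shiftMul f g (position z) t * fderiv ℝ (fun t => character t (frequency z)) t
        (EuclideanSpace.single j 1) =
        (-2 * Real.pi * Complex.I * z (Fin.natAdd d j)) * wignerKernel f g z t := by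
      intro t
      obtain ⟨L, hL, h⟩ := hasFDerivAt_character t (frequency z)
      rw [hL.fderiv, h, EuclideanSpace.inner_single_left]
      simp [wignerKernel, frequency]
      ring
    have key := integral_mul_fderiv_eq_neg_fderiv_mul_of_integrable
      (μ := (MeasureTheory.volume : MeasureTheory.Measure (EuclideanSpace ℝ (Fin d))))
      (f := fun t => shiftMul f g (position z) t) (g := fun t => character t (frequency z))
      (v := EuclideanSpace.single j (1 : ℝ)) ?_ ?_ (integrable_wignerKernel f g z)
      (fun t _ => (hasFDerivAt_shiftMul f g (position z) t).choose_spec.1.differentiableAt)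
      (fun t _ => (hasFDerivAt_character t (frequency z)).choose_spec.1.differentiableAt)
    · simp only [e1, e2] at key
      rw [← hadd, MeasureTheory.integral_const_mul, ← crossWigner_eq] at key
      have hpi' : (Real.pi : ℂ) ≠ 0 := by exact_mod_cast Real.pi_ne_zero
      have hI := Complex.I_ne_zero
      field_simp
      linear_combination (-2) * key
    · simp only [e1]
      exact ((integrable_wignerKernel _ _ z).const_mul _).add
        ((integrable_wignerKernel _ _ z).const_mul _)
    · simp only [e2]
      exact (integrable_wignerKernel _ _ z).const_mul _

/-! ### Differentiation under the integral and Schwartz regularity of W(f,g). -/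

theorem clm_eq_sum {n : ℕ} (L : EuclideanSpace ℝ (Fin n) →L[ℝ] ℂ) :
    L = ∑ k, (EuclideanSpace.proj (𝕜 := ℝ) k).smulRight (L (EuclideanSpace.single k 1)) := by
  ext x
  have hx := (EuclideanSpace.basisFun (Fin n) ℝ).sum_repr x
  conv_lhs => rw [← hx]
  simp

theorem differentiable_wignerKernel (f g : 𝓢(EuclideanSpace ℝ (Fin d), ℂ))
    (t : EuclideanSpace ℝ (Fin d)) : Differentiable ℝ fun z => wignerKernel f g z t :=
  fun z => (hasFDerivAt_wignerKernel f g z t).choose_spec.1.differentiableAt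

theorem hasFDerivAt_crossWigner (f g : 𝓢(EuclideanSpace ℝ (Fin d), ℂ))
    (z : EuclideanSpace ℝ (Fin (d + d))) :
    MeasureTheory.Integrable (fun t => fderiv ℝ (fun z => wignerKernel f g z t) z) ∧
    HasFDerivAt (crossWigner f g) (∫ t, fderiv ℝ (fun z => wignerKernel f g z t) z) z := by
  choose c₁ c₂ b hc₁ hc₂ h using exists_fderiv_wignerKernel (d := d)
  have hmeas : MeasureTheory.AEStronglyMeasurable
      (fun t => fderiv ℝ (fun z => wignerKernel f g z t) z)
      (MeasureTheory.volume : MeasureTheory.Measure (EuclideanSpace ℝ (Fin d))) := by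
    -- Measurability in t: by the intertwining relation, the coordinates of the derivative are
    -- combinations of kernels, which are continuous in t.
    have : (fun t => fderiv ℝ (fun z => wignerKernel f g z t) z) = fun t => ∑ k,
        (ContinuousLinearMap.smulRightL ℝ (EuclideanSpace ℝ (Fin (d + d))) ℂ
          (EuclideanSpace.proj (𝕜 := ℝ) k)) (c₁ k * wignerKernel (letter (b k) f) g z t +
            c₂ k * wignerKernel f (letter (b k) g) z t) := by
      ext1 t
      rw [clm_eq_sum (fderiv ℝ (fun z => wignerKernel f g z t) z)]
      simp only [h]
      rfl
    rw [this]
    refine (continuous_finsetSum _ fun k _ => ?_).aestronglyMeasurable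
    refine (ContinuousLinearMap.continuous _).comp ?_
    exact ((continuous_wignerKernel _ _ z).const_mul _).add
      ((continuous_wignerKernel _ _ z).const_mul _)
  have hC : ∀ k, ∃ C, ∀ z t, ‖c₁ k * wignerKernel (letter (b k) f) g z t +
      c₂ k * wignerKernel f (letter (b k) g) z t‖ ≤ C * ((1 + ‖t‖) ^ (d + 1))⁻¹ := by
    intro k
    obtain ⟨C, hC⟩ := exists_norm_wignerKernel_le (letter (b k) f) g
    obtain ⟨D, hD⟩ := exists_norm_wignerKernel_le f (letter (b k) g)
    refine ⟨‖c₁ k‖ * C + ‖c₂ k‖ * D, fun z t => (norm_add_le _ _).trans ?_⟩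
    rw [norm_mul, norm_mul, add_mul, mul_assoc, mul_assoc]
    gcongr
    · exact hC z t
    · exact hD z t
  choose C hC using hC
  have hbound : ∀ t z, ‖fderiv ℝ (fun z => wignerKernel f g z t) z‖ ≤
      (∑ k, ‖(EuclideanSpace.proj k : EuclideanSpace ℝ (Fin (d + d)) →L[ℝ] ℝ)‖ * C k) *
        ((1 + ‖t‖) ^ (d + 1))⁻¹ := by
    intro t z
    rw [clm_eq_sum (fderiv ℝ (fun z => wignerKernel f g z t) z), Finset.sum_mul]
    refine (norm_sum_le _ _).trans (Finset.sum_le_sum fun k _ => ?_)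
    rw [ContinuousLinearMap.norm_smulRight_apply, h, mul_assoc]
    exact mul_le_mul_of_nonneg_left (hC k z t) (norm_nonneg _)
  have hint := integrable_one_add_norm_pow (d := d).const_mul
    (∑ k, ‖(EuclideanSpace.proj k : EuclideanSpace ℝ (Fin (d + d)) →L[ℝ] ℝ)‖ * C k)
  refine ⟨hint.mono' hmeas (Filter.Eventually.of_forall fun t => hbound t z), ?_⟩
  exact hasFDerivAt_integral_of_dominated_of_fderiv_le Filter.univ_mem
    (Filter.Eventually.of_forall fun z => (continuous_wignerKernel f g z).aestronglyMeasurable)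
    (integrable_wignerKernel f g z) hmeas
    (Filter.Eventually.of_forall fun t z _ => hbound t z) hint
    (Filter.Eventually.of_forall fun t z _ => (differentiable_wignerKernel f g t z).hasFDerivAt)

theorem exists_fderiv_crossWigner (k : Fin (d + d)) : ∃ (c₁ c₂ : ℂ) (b : Fin d ⊕ Fin d),
    ‖c₁‖ ≤ 2 * Real.pi ∧ ‖c₂‖ ≤ 2 * Real.pi ∧
    ∀ (f g : 𝓢(EuclideanSpace ℝ (Fin d), ℂ)) (z : EuclideanSpace ℝ (Fin (d + d))),
      fderiv ℝ (crossWigner f g) z (EuclideanSpace.single k 1) =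
        c₁ * crossWigner (letter b f) g z + c₂ * crossWigner f (letter b g) z := by
  obtain ⟨c₁, c₂, b, hc₁, hc₂, h⟩ := exists_fderiv_wignerKernel k
  refine ⟨c₁, c₂, b, hc₁, hc₂, fun f g z => ?_⟩
  obtain ⟨h1, h2⟩ := hasFDerivAt_crossWigner f g z
  rw [h2.fderiv, ContinuousLinearMap.integral_apply h1]
  simp only [h]
  rw [MeasureTheory.integral_add ((integrable_wignerKernel _ _ z).const_mul c₁)
    ((integrable_wignerKernel _ _ z).const_mul c₂), MeasureTheory.integral_const_mul,
    MeasureTheory.integral_const_mul, crossWigner_eq, crossWigner_eq]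

/-- The derivative is again built from cross-Wigner distributions of Schwartz functions, with
coefficients independent of f and g, so smoothness and decay follow by induction over all pairs at
once. -/
theorem exists_fderiv_crossWigner_eq_sum : ∃ (c₁ c₂ : Fin (d + d) → ℂ)
    (b : Fin (d + d) → Fin d ⊕ Fin d), ∀ f g : 𝓢(EuclideanSpace ℝ (Fin d), ℂ),
      fderiv ℝ (crossWigner f g) = ∑ k,
        (ContinuousLinearMap.smulRightL ℝ (EuclideanSpace ℝ (Fin (d + d))) ℂ
          (EuclideanSpace.proj (𝕜 := ℝ) k)) ∘ (c₁ k • crossWigner (letter (b k) f) g +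
            c₂ k • crossWigner f (letter (b k) g)) := by
  choose c₁ c₂ b _ _ h using exists_fderiv_crossWigner (d := d)
  refine ⟨c₁, c₂, b, fun f g => ?_⟩
  ext1 z
  rw [clm_eq_sum (fderiv ℝ (crossWigner f g) z)]
  simp only [h, Finset.sum_apply]
  rfl

theorem contDiff_crossWigner (m : ℕ) : ∀ f g : 𝓢(EuclideanSpace ℝ (Fin d), ℂ),
    ContDiff ℝ m (crossWigner f g) := by
  obtain ⟨c₁, c₂, b, h⟩ := exists_fderiv_crossWigner_eq_sum (d := d)
  induction m with
  | zero =>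
    intro f g
    have : Differentiable ℝ (crossWigner f g) :=
      fun z => (hasFDerivAt_crossWigner f g z).2.differentiableAt
    exact contDiff_zero.2 this.continuous
  | succ m ih =>
    intro f g
    push_cast
    rw [contDiff_succ_iff_fderiv]
    refine ⟨fun z => (hasFDerivAt_crossWigner f g z).2.differentiableAt, by simp, ?_⟩
    rw [h, Finset.sum_fn]
    refine ContDiff.sum fun k _ => ?_
    exact (ContinuousLinearMap.contDiff _).comp
      (((ih _ _).const_smul (c₁ k)).add ((ih _ _).const_smul (c₂ k)))

theorem exists_norm_pow_mul_crossWigner_le (k : ℕ) :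
    ∀ f g : 𝓢(EuclideanSpace ℝ (Fin d), ℂ), ∃ C, ∀ z : EuclideanSpace ℝ (Fin (d + d)),
      ‖z‖ ^ k * ‖crossWigner f g z‖ ≤ C := by
  induction k with
  | zero =>
    intro f g
    obtain ⟨P, hP⟩ := exists_one_add_norm_pow_le f (d + 1)
    obtain ⟨Q, hQ⟩ := exists_one_add_norm_pow_le g (d + 1)
    exact ⟨_, fun z => by simpa using norm_crossWigner_le hP hQ z⟩
  | succ k ih =>
    intro f g
    choose c₁ c₂ b _ _ h using exists_coord_mul_crossWigner (d := d)
    choose C hC using ih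
    refine ⟨∑ i, (‖c₁ i‖ * C (letter (b i) f) g + ‖c₂ i‖ * C f (letter (b i) g)), fun z => ?_⟩
    calc ‖z‖ ^ (k + 1) * ‖crossWigner f g z‖ = ‖z‖ * (‖z‖ ^ k * ‖crossWigner f g z‖) := by ring
      _ ≤ (∑ i, ‖z i‖) * (‖z‖ ^ k * ‖crossWigner f g z‖) := by
          gcongr; exact norm_le_sum_norm_coord z
      _ = ∑ i, ‖z‖ ^ k * ‖(z i : ℂ) * crossWigner f g z‖ := by
          rw [Finset.sum_mul]
          refine Finset.sum_congr rfl fun i _ => ?_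
          rw [norm_mul, Complex.norm_real]; ring
      _ ≤ _ := by
          refine Finset.sum_le_sum fun i _ => ?_
          rw [h]
          calc _ ≤ ‖z‖ ^ k * (‖c₁ i * crossWigner (letter (b i) f) g z‖ +
                ‖c₂ i * crossWigner f (letter (b i) g) z‖) := by gcongr; exact norm_add_le _ _
            _ = ‖c₁ i‖ * (‖z‖ ^ k * ‖crossWigner (letter (b i) f) g z‖) +
                ‖c₂ i‖ * (‖z‖ ^ k * ‖crossWigner f (letter (b i) g) z‖) := by
              rw [norm_mul, norm_mul]; ring
            _ ≤ _ := by gcongr <;> exact hC _ _ z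

theorem exists_norm_pow_mul_iteratedFDeriv_crossWigner_le (k m : ℕ) :
    ∀ f g : 𝓢(EuclideanSpace ℝ (Fin d), ℂ), ∃ C, ∀ z : EuclideanSpace ℝ (Fin (d + d)),
      ‖z‖ ^ k * ‖iteratedFDeriv ℝ m (crossWigner f g) z‖ ≤ C := by
  induction m with
  | zero => simpa using exists_norm_pow_mul_crossWigner_le k
  | succ m ih =>
    intro f g
    obtain ⟨c₁, c₂, b, h⟩ := exists_fderiv_crossWigner_eq_sum (d := d)
    choose C hC using ih
    set L := fun k => ContinuousLinearMap.smulRightL ℝ (EuclideanSpace ℝ (Fin (d + d))) ℂ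
          (EuclideanSpace.proj (𝕜 := ℝ) k)
    refine ⟨∑ i, ‖L i‖ * (‖c₁ i‖ * C (letter (b i) f) g + ‖c₂ i‖ * C f (letter (b i) g)),
      fun z => ?_⟩
    have hd₁ : ∀ i, ContDiff ℝ m (c₁ i • crossWigner (letter (b i) f) g) := fun i =>
      (contDiff_crossWigner m _ _).const_smul (c₁ i)
    have hd₂ : ∀ i, ContDiff ℝ m (c₂ i • crossWigner f (letter (b i) g)) := fun i =>
      (contDiff_crossWigner m _ _).const_smul (c₂ i)
    have hd : ∀ i, ContDiff ℝ m (c₁ i • crossWigner (letter (b i) f) g +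
        c₂ i • crossWigner f (letter (b i) g)) := fun i => (hd₁ i).add (hd₂ i)
    rw [← norm_iteratedFDeriv_fderiv, h, iteratedFDeriv_sum_apply
      (fun i _ => ((L i).contDiff.comp (hd i)).contDiffAt)]
    refine (mul_le_mul_of_nonneg_left (norm_sum_le _ _) (by positivity)).trans ?_
    rw [Finset.mul_sum]
    refine Finset.sum_le_sum fun i _ => ?_
    calc _ ≤ ‖z‖ ^ k * (‖L i‖ * ‖iteratedFDeriv ℝ m (c₁ i • crossWigner (letter (b i) f) g +
            c₂ i • crossWigner f (letter (b i) g)) z‖) := by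
          gcongr
          exact (L i).norm_iteratedFDeriv_comp_left (hd i).contDiffAt le_rfl
      _ ≤ ‖z‖ ^ k * (‖L i‖ * (‖c₁ i‖ * ‖iteratedFDeriv ℝ m (crossWigner (letter (b i) f) g) z‖ +
            ‖c₂ i‖ * ‖iteratedFDeriv ℝ m (crossWigner f (letter (b i) g)) z‖)) := by
          gcongr
          rw [iteratedFDeriv_add_apply (hd₁ i).contDiffAt (hd₂ i).contDiffAt,
            iteratedFDeriv_const_smul_apply (contDiff_crossWigner m _ _).contDiffAt,
            iteratedFDeriv_const_smul_apply (contDiff_crossWigner m _ _).contDiffAt,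
            ← norm_smul, ← norm_smul]
          exact norm_add_le _ _
      _ = ‖L i‖ * (‖c₁ i‖ * (‖z‖ ^ k * ‖iteratedFDeriv ℝ m (crossWigner (letter (b i) f) g) z‖) +
            ‖c₂ i‖ * (‖z‖ ^ k * ‖iteratedFDeriv ℝ m (crossWigner f (letter (b i) g)) z‖)) := by
          ring
      _ ≤ _ := by gcongr <;> exact hC _ _ z

/-! ### Word bounds for the Wigner transform. -/

/-- The cross-Wigner distribution of two Schwartz functions, as a Schwartz function. -/
def schwartzWigner (f g : 𝓢(EuclideanSpace ℝ (Fin d), ℂ)) :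
    𝓢(EuclideanSpace ℝ (Fin (d + d)), ℂ) where
  toFun := crossWigner f g
  smooth' := contDiff_infty.2 fun m => contDiff_crossWigner m f g
  decay' k m := exists_norm_pow_mul_iteratedFDeriv_crossWigner_le k m f g

theorem coe_schwartzWigner (f g : 𝓢(EuclideanSpace ℝ (Fin d), ℂ)) :
    ⇑(schwartzWigner f g) = crossWigner f g := rfl

theorem exists_letter_schwartzWigner (a : Fin (d + d) ⊕ Fin (d + d)) :
    ∃ (c₁ c₂ : ℂ) (b : Fin d ⊕ Fin d), ‖c₁‖ ≤ 2 * Real.pi ∧ ‖c₂‖ ≤ 2 * Real.pi ∧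
      ∀ f g : 𝓢(EuclideanSpace ℝ (Fin d), ℂ), letter a (schwartzWigner f g) =
        c₁ • schwartzWigner (letter b f) g + c₂ • schwartzWigner f (letter b g) := by
  rcases a with k | k
  · obtain ⟨c₁, c₂, b, hc₁, hc₂, h⟩ := exists_coord_mul_crossWigner k
    refine ⟨c₁, c₂, b, hc₁, hc₂, fun f g => ?_⟩
    ext z
    simpa [letter, coe_schwartzWigner] using h f g z
  · obtain ⟨c₁, c₂, b, hc₁, hc₂, h⟩ := exists_fderiv_crossWigner k
    refine ⟨c₁, c₂, b, hc₁, hc₂, fun f g => ?_⟩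
    ext z
    simpa [letter, coe_schwartzWigner, coordDeriv_apply] using h f g z

theorem norm_word_schwartzWigner_le {f g : 𝓢(EuclideanSpace ℝ (Fin d), ℂ)} {w : ℕ → ℝ}
    (h : ∀ (U V : List (Fin d ⊕ Fin d)) (z : EuclideanSpace ℝ (Fin (d + d))),
      ‖schwartzWigner (word U f) (word V g) z‖ ≤ w (U.length + V.length))
    (T : List (Fin (d + d) ⊕ Fin (d + d))) :
    ∀ (U V : List (Fin d ⊕ Fin d)) (z : EuclideanSpace ℝ (Fin (d + d))),
      ‖word T (schwartzWigner (word U f) (word V g)) z‖ ≤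
        (4 * Real.pi) ^ T.length * w (U.length + V.length + T.length) := by
  -- The last letter of T acts first on W(f,g), so it is the one moved onto f or g.
  induction T using List.reverseRecOn with
  | nil => simpa [word] using h
  | append_singleton T a ih =>
    intro U V z
    obtain ⟨c₁, c₂, b, hc₁, hc₂, hb⟩ := exists_letter_schwartzWigner a
    rw [word_append_singleton, hb, map_add, map_smul, map_smul, ← word_cons, ← word_cons]
    have h1 := ih (b :: U) V z
    have h2 := ih U (b :: V) z
    rw [List.length_cons, show U.length + 1 + V.length + T.length =
      U.length + V.length + (T.length + 1) by ring] at h1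
    rw [List.length_cons, show U.length + (V.length + 1) + T.length =
      U.length + V.length + (T.length + 1) by ring] at h2
    rw [List.length_append, List.length_singleton]
    set M := (4 * Real.pi) ^ T.length * w (U.length + V.length + (T.length + 1)) with hM
    calc _ ≤ ‖c₁‖ * ‖word T (schwartzWigner (word (b :: U) f) (word V g)) z‖ +
          ‖c₂‖ * ‖word T (schwartzWigner (word U f) (word (b :: V) g)) z‖ := by
          rw [← norm_mul, ← norm_mul]
          exact norm_add_le _ _
      _ ≤ 2 * Real.pi * M + 2 * Real.pi * M := by gcongr
      _ = _ := by rw [hM, pow_succ]; ring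

/-- The weight exponent d + 1 makes the t-integral converge, and |U|! |V|! ≤ (|U| + |V|)! merges the
two word bounds into one. -/
theorem WordBound.schwartzWigner {s A : ℝ} (hs : 0 ≤ s) (hA : 0 < A)
    {f g : 𝓢(EuclideanSpace ℝ (Fin d), ℂ)} (hf : WordBound s A f) (hg : WordBound s A g) :
    WordBound s (4 * Real.pi * (((2 : ℝ) ^ s) ^ (d + 1) * A)) (schwartzWigner f g) := by
  obtain ⟨P, hP0, hP⟩ := hf.one_add_norm_pow hs (d + 1) hA
  obtain ⟨Q, hQ0, hQ⟩ := hg.one_add_norm_pow hs (d + 1) hA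
  set D := ((2 : ℝ) ^ s) ^ (d + 1) * A
  set I := ∫ t : EuclideanSpace ℝ (Fin d), ((1 + ‖t‖) ^ (d + 1))⁻¹
  have hI : 0 ≤ I := MeasureTheory.integral_nonneg fun t => by positivity
  refine ⟨P * Q * I, by positivity, fun T z => ?_⟩
  have key := norm_word_schwartzWigner_le (f := f) (g := g)
    (w := fun m => P * Q * I * (D ^ m * (m.factorial : ℝ) ^ s)) ?_ T [] [] z
  · simp only [List.length_nil, Nat.zero_add] at key
    refine key.trans (le_of_eq ?_)
    rw [mul_pow]
    ring
  · intro U V z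
    refine (norm_crossWigner_le (hP U) (hQ V) z).trans ?_
    have h3 := Nat.le_of_dvd (Nat.factorial_pos _)
      (Nat.factorial_mul_factorial_dvd_factorial_add U.length V.length)
    have h4 : (U.length.factorial : ℝ) ^ s * (V.length.factorial : ℝ) ^ s ≤
        ((U.length + V.length).factorial : ℝ) ^ s := by
      rw [← Real.mul_rpow (Nat.cast_nonneg _) (Nat.cast_nonneg _)]
      exact Real.rpow_le_rpow (by positivity) (by exact_mod_cast h3) hs
    calc _ = P * Q * I * (D ^ (U.length + V.length) *
          ((U.length.factorial : ℝ) ^ s * (V.length.factorial : ℝ) ^ s)) := by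
          rw [pow_add]; ring
      _ ≤ _ := by gcongr

end

end GelfandShilov

end

/-! ### Conclusion. -/

theorem mainTheorem3 (d : ℕ) :
    (∀ s : ℝ, 1 / 2 ≤ s → ∀ f g : EuclideanSpace ℝ (Fin d) → ℂ,
      f ∈ GelfandShilov.spaceS d s s → g ∈ GelfandShilov.spaceS d s s →
        GelfandShilov.crossWigner f g ∈ GelfandShilov.spaceS (d + d) s s) ∧
    (∀ f g : EuclideanSpace ℝ (Fin d) → ℂ,
      f ∈ GelfandShilov.spaceSigma d 1 1 → g ∈ GelfandShilov.spaceSigma d 1 1 →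
        GelfandShilov.crossWigner f g ∈ GelfandShilov.spaceSigma (d + d) 1 1) := by
  open GelfandShilov in
  refine ⟨?_, ?_⟩
  · rintro s hs _ _ ⟨f, rfl, A, B, hA, hB, hf⟩ ⟨g, rfl, A', B', hA', hB', hg⟩
    have hs0 : 0 ≤ s := by linarith
    obtain ⟨M, hM, hf⟩ := exists_wordBound hs hA hB hf
    obtain ⟨M', hM', hg⟩ := exists_wordBound hs hA' hB' hg
    have hW := WordBound.schwartzWigner hs0 (lt_max_of_lt_left hM)
      (hf.mono hM.le (le_max_left M M')) (hg.mono hM'.le (le_max_right M M'))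
    have hpi := Real.pi_pos
    have hmax : 0 < max M M' := lt_max_of_lt_left hM
    exact ⟨schwartzWigner f g, rfl, _, _, by positivity, by positivity,
      hW.estimate hs0 (by positivity)⟩
  · rintro _ _ ⟨f, rfl, hf⟩ ⟨g, rfl, hg⟩
    refine ⟨schwartzWigner f g, rfl, fun A B hA hB => ?_⟩
    have hpi := Real.pi_pos
    -- K collects every loss from the constant for f and g to the one for W(f,g), the last 2 being
    -- that of `wordBound_one`. It depends only on d, so applying the hypotheses with m / K produces
    -- exactly m = min A B.
    set K : ℝ := (2 * ((d + d : ℕ) + 1) : ℝ) ^ (1 : ℝ) *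
      (4 * Real.pi * (((2 : ℝ) ^ (1 : ℝ)) ^ (d + 1) * 2)) with hK
    have hK0 : 0 < K := by positivity
    set m := min A B with hm
    have hm0 : 0 < m := lt_min hA hB
    have hM : 0 < m / K := by positivity
    have hW := (WordBound.schwartzWigner zero_le_one (by positivity)
      (wordBound_one hM (hf _ _ hM hM)) (wordBound_one hM (hg _ _ hM hM))).estimate
      zero_le_one (by positivity)
    have e : (2 * ((d + d : ℕ) + 1) : ℝ) ^ (1 : ℝ) *
        (4 * Real.pi * (((2 : ℝ) ^ (1 : ℝ)) ^ (d + 1) * (2 * (m / K)))) = m := by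
      calc _ = K * (m / K) := by rw [hK]; ring
        _ = m := by field_simp
    rw [e] at hW
    exact hW.mono hm0.le hm0.le (min_le_left _ _) (min_le_right _ _)
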